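/- Let $M$ be a smooth $n$-dimensional manifold and let $f\colon M\to\mathbb R^{n+1}$ be a smooth immersion with a centroaffine normalization centred at $0$: a transversal vector field $\xi=c f$ with a constant $c\neq 0$, so that $\mathbb R^{n+1}=f_*(T_xM)\oplus\mathbb R\,\xi_x$ for all $x\in M$. Let $\nabla$ be the induced connection on $M$, given by the Gauss formula $D_X f_*Y=f_*\nabla_XY+g(X,Y)\,\xi$, where $D$ is the standard flat connection of $\mathbb R^{n+1}$. On every $2$-dimensional vector subspace $\pi\subset\mathbb R^{n+1}$ fix an arbitrary determinant $\det$, i.e. a nonzero alternating bilinear form. A curve in $\pi$ means here a smooth regular curve $\gamma\colon I\to M$ on a nonempty open interval $I$ with $f(\gamma(I))\subset\pi$. It is called maximal if it is not, up to a regular change of parameter, the restriction of another such curve $\sigma\colon J\to M$ in $\pi$ to a proper subinterval of $J$. Suppose that for every such plane $\pi$, every maximal curve in $\pi$ has a regular parametrization $\gamma\colon\mathbb R\to M$ on the whole of $\mathbb R$ (obtained from the given one by a smooth change of parameter) for which there is $\varepsilon>0$ with $|\det((f\circ\gamma)(t),(f\circ\gamma)'(t))|\ge\varepsilon$ for all $t\in\mathbb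 R$. Then $\nabla$ is complete: every $\nabla$-geodesic extends to a $\nabla$-geodesic whose affine parameter runs through all of $\mathbb R$. -/

import Mathlib

open scoped Manifold ContDiff

noncomputable section

namespace AffineHypersurface

/-! ### Geodesics and completeness of an affine connection -/

section Connection

variable {n : ℕ} {M : Type*} [TopologicalSpace M] [ChartedSpace (EuclideanSpace ℝ (Fin n)) M]

/-- The velocity `γ'(t)` of a curve in a manifold. -/
def velocity (n : ℕ) {M : Type*} [TopologicalSpace M] [ChartedSpace (EuclideanSpace ℝ (Fin n)) M]
    (γ : ℝ → M) (t : ℝ) : TangentSpace (𝓡 n) (γ t) :=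
  mfderiv 𝓘(ℝ, ℝ) (𝓡 n) γ t (1 : ℝ)

/-- The covariant derivative `(D/dt) V` at `t` of a vector field `V` along the curve `γ`, for the
connection `cov` (`cov Y x v` is `∇_v Y`). In the coordinate frame `E₁, …, Eₙ` around `γ(t)` write
`V(s) = ∑ aⁱ(s) Eᵢ(γ(s))`; the value is `∑ (aⁱ)'(t) Eᵢ + ∑ aⁱ(t) ∇_{γ'(t)} Eᵢ`. The first sum is
the first summand below; `FiberBundle.extend _ (V t)` is the local field `∑ aⁱ(t) Eᵢ` with
constant coefficients, so that the second sum is the second summand. -/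
def covariantDerivAlong [IsManifold (𝓡 n) ∞ M]
    (cov : CovariantDerivative (𝓡 n) (EuclideanSpace ℝ (Fin n))
      (TangentSpace (𝓡 n) : M → Type _))
    (γ : ℝ → M) (V : ∀ t, TangentSpace (𝓡 n) (γ t)) (t : ℝ) : TangentSpace (𝓡 n) (γ t) :=
  (trivializationAt (EuclideanSpace ℝ (Fin n)) (TangentSpace (𝓡 n) : M → Type _) (γ t)).symm (γ t)
      (deriv (fun s : ℝ =>
        (trivializationAt (EuclideanSpace ℝ (Fin n)) (TangentSpace (𝓡 n) : M → Type _) (γ t)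
          ⟨γ s, V s⟩).2) t)
    + cov (FiberBundle.extend (EuclideanSpace ℝ (Fin n)) (V t)) (γ t) (velocity n γ t)

/-- `γ` restricted to the nonempty open interval `I` is a geodesic with affine parameter:
it is smooth and `∇_{γ'} γ' = 0`. -/
structure IsGeodesicOn [IsManifold (𝓡 n) ∞ M]
    (cov : CovariantDerivative (𝓡 n) (EuclideanSpace ℝ (Fin n))
      (TangentSpace (𝓡 n) : M → Type _))
    (γ : ℝ → M) (I : Set ℝ) : Prop where
  isOpen : IsOpen I
  ordConnected : I.OrdConnected
  nonempty : I.Nonempty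
  smooth : ContMDiffOn 𝓘(ℝ, ℝ) (𝓡 n) ∞ γ I
  geodesic : ∀ t ∈ I, covariantDerivAlong cov γ (velocity n γ) t = 0

/-- A connection is complete if every geodesic extends to a geodesic whose affine parameter runs
through all of `ℝ`. -/
def IsCompleteConnection [IsManifold (𝓡 n) ∞ M]
    (cov : CovariantDerivative (𝓡 n) (EuclideanSpace ℝ (Fin n))
      (TangentSpace (𝓡 n) : M → Type _)) : Prop :=
  ∀ (γ : ℝ → M) (I : Set ℝ), IsGeodesicOn cov γ I →
    ∃ σ : ℝ → M, IsGeodesicOn cov σ Set.univ ∧ Set.EqOn σ γ I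

end Connection

/-! ### Hypersurfaces with a transversal field and their induced connection -/

section Hypersurface

variable {n : ℕ} {M : Type*} [TopologicalSpace M] [ChartedSpace (EuclideanSpace ℝ (Fin n)) M]

/-- `f : M → ℝⁿ⁺¹` is a smooth immersed hypersurface and `ξ` is a smooth transversal vector field
for it. -/
structure IsTransversalField (f ξ : M → EuclideanSpace ℝ (Fin (n + 1))) : Prop where
  smooth_immersion : ContMDiff (𝓡 n) 𝓘(ℝ, EuclideanSpace ℝ (Fin (n + 1))) ∞ f
  injective_mvfderiv : ∀ x, Function.Injective (mvfderiv (𝓡 n) f x)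
  smooth_field : ContMDiff (𝓡 n) 𝓘(ℝ, EuclideanSpace ℝ (Fin (n + 1))) ∞ ξ
  transversal : ∀ x, ∀ u : TangentSpace (𝓡 n) x, mvfderiv (𝓡 n) f x u ≠ ξ x

/-- The transversal field `ξ` is a centroaffine normalization of `f` with center `0`: it is a
nonzero constant multiple of the position vector. -/
def IsCentroaffineNormalization (f ξ : M → EuclideanSpace ℝ (Fin (n + 1))) : Prop :=
  IsTransversalField f ξ ∧ ∃ c : ℝ, c ≠ 0 ∧ ∀ x, ξ x = c • f x

/-- The map `(u, s) ↦ f_* u + s ξ_x` from `T_x M × ℝ` to `ℝⁿ⁺¹`. -/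
def splitMap (f ξ : M → EuclideanSpace ℝ (Fin (n + 1))) (x : M) :
    (TangentSpace (𝓡 n) x × ℝ) →ₗ[ℝ] EuclideanSpace ℝ (Fin (n + 1)) :=
  LinearMap.coprod (mvfderiv (𝓡 n) f x).toLinearMap (LinearMap.toSpanSingleton ℝ _ (ξ x))

theorem splitMap_bijective {f ξ : M → EuclideanSpace ℝ (Fin (n + 1))}
    (h : IsTransversalField f ξ) (x : M) : Function.Bijective (splitMap f ξ x) := by
  have hinj : Function.Injective (splitMap f ξ x) := by
    rw [injective_iff_map_eq_zero]
    rintro ⟨u, s⟩ hus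
    have hus' : mvfderiv (𝓡 n) f x u + s • ξ x = 0 := by simpa [splitMap] using hus
    have hs : s = 0 := by
      by_contra hs
      apply h.transversal x (-(s⁻¹ • u))
      have h1 : mvfderiv (𝓡 n) f x u = -(s • ξ x) := eq_neg_of_add_eq_zero_left hus'
      rw [map_neg, map_smul, h1, smul_neg, neg_neg, smul_smul, inv_mul_cancel₀ hs, one_smul]
    subst hs
    have hu : u = 0 := by
      apply h.injective_mvfderiv x
      simpa using hus'
    simp [hu]
  have : FiniteDimensional ℝ (TangentSpace (𝓡 n) x) :=
    inferInstanceAs (FiniteDimensional ℝ (EuclideanSpace ℝ (Fin n)))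
  have hd : Module.finrank ℝ (TangentSpace (𝓡 n) x × ℝ)
      = Module.finrank ℝ (EuclideanSpace ℝ (Fin (n + 1))) := by
    have : Module.finrank ℝ (TangentSpace (𝓡 n) x) = n := finrank_euclideanSpace_fin (𝕜 := ℝ)
    rw [Module.finrank_prod, this]
    simp
  exact ⟨hinj, (LinearMap.injective_iff_surjective_of_finrank_eq_finrank hd).1 hinj⟩

/-- The tangential component of a vector: the `u ∈ T_x M` with `w = f_* u + s ξ_x`. -/
def tangentialPart {f ξ : M → EuclideanSpace ℝ (Fin (n + 1))} (h : IsTransversalField f ξ)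
    (x : M) : EuclideanSpace ℝ (Fin (n + 1)) →L[ℝ] TangentSpace (𝓡 n) x :=
  LinearMap.toContinuousLinearMap
    ((LinearMap.fst ℝ (TangentSpace (𝓡 n) x) ℝ).comp
      (LinearEquiv.ofBijective (splitMap f ξ x) (splitMap_bijective h x)).symm.toLinearMap)

theorem tangentialPart_mvfderiv {f ξ : M → EuclideanSpace ℝ (Fin (n + 1))}
    (h : IsTransversalField f ξ) (x : M) (u : TangentSpace (𝓡 n) x) :
    tangentialPart h x (mvfderiv (𝓡 n) f x u) = u := by
  have h1 : splitMap f ξ x (u, 0) = mvfderiv (𝓡 n) f x u := by simp [splitMap]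
  have h2 : (LinearEquiv.ofBijective (splitMap f ξ x) (splitMap_bijective h x)).symm
      (mvfderiv (𝓡 n) f x u) = (u, 0) := by
    rw [LinearEquiv.symm_apply_eq]; exact h1.symm
  simp [tangentialPart, h2]

theorem mdifferentiableAt_pushforward [IsManifold (𝓡 n) ∞ M]
    {f : M → EuclideanSpace ℝ (Fin (n + 1))}
    (hf : ContMDiff (𝓡 n) 𝓘(ℝ, EuclideanSpace ℝ (Fin (n + 1))) ∞ f)
    {Y : ∀ x : M, TangentSpace (𝓡 n) x} {x : M}
    (hY : MDifferentiableAt (𝓡 n) (𝓡 n).tangent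
      (fun y => (⟨y, Y y⟩ : TangentBundle (𝓡 n) M)) x) :
    MDifferentiableAt (𝓡 n) 𝓘(ℝ, EuclideanSpace ℝ (Fin (n + 1)))
      (fun y => mvfderiv (𝓡 n) f y (Y y)) x := by
  have h1 : ContMDiff (𝓡 n).tangent 𝓘(ℝ, EuclideanSpace ℝ (Fin (n + 1))).tangent 1
      (tangentMap (𝓡 n) 𝓘(ℝ, EuclideanSpace ℝ (Fin (n + 1))) f) :=
    hf.contMDiff_tangentMap (by norm_cast)
  have h2 := MDifferentiableAt.comp (f := fun y => (⟨y, Y y⟩ : TangentBundle (𝓡 n) M)) x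
    ((h1.mdifferentiable one_ne_zero) ⟨x, Y x⟩) hY
  rw [mdifferentiableAt_totalSpace] at h2
  have h3 := h2.2
  simp only [tangentMap, Function.comp_def, trivializationAt_model_space_apply] at h3
  exact h3

/-- The connection induced on `M` by the transversal field `ξ`: `∇_v Y` is the tangential component
of `D_v (f_* Y)`, as in the Gauss formula `D_v (f_* Y) = f_* (∇_v Y) + g(v, Y) ξ`. -/
def inducedConnection [IsManifold (𝓡 n) ∞ M] {f ξ : M → EuclideanSpace ℝ (Fin (n + 1))}
    (h : IsTransversalField f ξ) :
    CovariantDerivative (𝓡 n) (EuclideanSpace ℝ (Fin n))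
      (TangentSpace (𝓡 n) : M → Type _) where
  toFun Y x := (tangentialPart h x).comp
    (mvfderiv (𝓡 n) (fun y => mvfderiv (𝓡 n) f y (Y y)) x)
  isCovariantDerivativeOnUniv :=
    { add := by
        intro Y Z x hY hZ _
        have hY' := mdifferentiableAt_pushforward h.smooth_immersion hY
        have hZ' := mdifferentiableAt_pushforward h.smooth_immersion hZ
        have e : (fun y => mvfderiv (𝓡 n) f y ((Y + Z) y))
            = (fun y => mvfderiv (𝓡 n) f y (Y y)) + fun y => mvfderiv (𝓡 n) f y (Z y) := by
          funext y; simp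
        rw [e, mvfderiv_add hY' hZ', ContinuousLinearMap.comp_add]
      leibniz := by
        intro Y g x hY hg _
        have hY' := mdifferentiableAt_pushforward h.smooth_immersion hY
        have e : (fun y => mvfderiv (𝓡 n) f y ((g • Y) y))
            = g • fun y => mvfderiv (𝓡 n) f y (Y y) := by
          funext y; simp
        rw [e, mvfderiv_smul hg hY']
        ext v
        simp [tangentialPart_mvfderiv] }

/-- The Gauss formula for the induced connection. -/
theorem gauss_formula [IsManifold (𝓡 n) ∞ M] {f ξ : M → EuclideanSpace ℝ (Fin (n + 1))}
    (h : IsTransversalField f ξ) (Y : ∀ x : M, TangentSpace (𝓡 n) x) (x : M)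
    (v : TangentSpace (𝓡 n) x) :
    ∃ s : ℝ, mvfderiv (𝓡 n) (fun y => mvfderiv (𝓡 n) f y (Y y)) x v
      = mvfderiv (𝓡 n) f x (inducedConnection h Y x v) + s • ξ x := by
  set w := mvfderiv (𝓡 n) (fun y => mvfderiv (𝓡 n) f y (Y y)) x v with hw
  set e := LinearEquiv.ofBijective (splitMap f ξ x) (splitMap_bijective h x)
  refine ⟨(e.symm w).2, ?_⟩
  have h1 : splitMap f ξ x (e.symm w) = w := e.apply_symm_apply w
  calc w = splitMap f ξ x (e.symm w) := h1.symm
    _ = _ := by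
      simp only [splitMap, LinearMap.coprod_apply]
      rfl

end Hypersurface

/-! ### Curves in planes through the origin -/

section PlaneCurve

variable {n : ℕ} {M : Type*} [TopologicalSpace M] [ChartedSpace (EuclideanSpace ℝ (Fin n)) M]

/-- `γ` restricted to the nonempty open interval `I` is a smooth regular curve in `M` whose image
under `f` lies in the plane `π`. -/
structure IsCurveInPlane (f : M → EuclideanSpace ℝ (Fin (n + 1)))
    (π : Submodule ℝ (EuclideanSpace ℝ (Fin (n + 1)))) (γ : ℝ → M) (I : Set ℝ) : Prop where
  isOpen : IsOpen I
  ordConnected : I.OrdConnected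
  nonempty : I.Nonempty
  smooth : ContMDiffOn 𝓘(ℝ, ℝ) (𝓡 n) ∞ γ I
  regular : ∀ t ∈ I, velocity n γ t ≠ 0
  mem_plane : ∀ t ∈ I, f (γ t) ∈ π

/-- `φ` is a regular change of parameter from the interval `I` onto the interval `J`. -/
structure IsParameterChange (φ : ℝ → ℝ) (I J : Set ℝ) : Prop where
  smooth : ContDiffOn ℝ ∞ φ I
  deriv_ne_zero : ∀ t ∈ I, deriv φ t ≠ 0
  image_eq : φ '' I = J

/-- The curve `γ : I → M` in the plane `π` is maximal: whenever it is, up to a change of parameter,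
the restriction of a curve `σ : J → M` in `π` to a subinterval `J' ⊆ J`, then `J' = J`. -/
structure IsMaximalCurveInPlane (f : M → EuclideanSpace ℝ (Fin (n + 1)))
    (π : Submodule ℝ (EuclideanSpace ℝ (Fin (n + 1)))) (γ : ℝ → M) (I : Set ℝ) : Prop where
  isCurveInPlane : IsCurveInPlane f π γ I
  maximal : ∀ (σ : ℝ → M) (J J' : Set ℝ) (φ : ℝ → ℝ), IsCurveInPlane f π σ J →
    J' ⊆ J → IsParameterChange φ I J' → (∀ t ∈ I, γ t = σ (φ t)) → J' = J

/-- The curve `γ : I → M` has a parametrization `γ ∘ φ` on all of `ℝ` such that, with `r = f ∘ γ ∘ φ`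
viewed as a curve in the plane `π`, the function `det (r, r')` is bounded away from zero. -/
def HasGlobalParametrization (f : M → EuclideanSpace ℝ (Fin (n + 1)))
    (π : Submodule ℝ (EuclideanSpace ℝ (Fin (n + 1)))) (det : π [⋀^Fin 2]→ₗ[ℝ] ℝ)
    (γ : ℝ → M) (I : Set ℝ) : Prop :=
  ∃ φ : ℝ → ℝ, IsParameterChange φ Set.univ I ∧
    ∃ r : ℝ → π, (∀ t, (r t : EuclideanSpace ℝ (Fin (n + 1))) = f (γ (φ t))) ∧
      ∃ c : ℝ, 0 < c ∧ ∀ t, c ≤ |det ![r t, deriv r t]|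

end PlaneCurve

end AffineHypersurface

end

/-! Write `r = f ∘ γ`. Since `ξ` is a nonzero multiple of the position vector, the Gauss formula
makes `γ` a geodesic exactly when `r''` is a multiple of `r` (`isGeodesicOn_iff`). Then `r ∧ r'` is
constant, so a nonconstant geodesic stays in a plane through the origin and `det (r, r')` is a
constant `C ≠ 0`.

Conversely, a regular curve in such a plane can be reparametrized so that `det (r, r') = C`.
Differentiating gives `det (r, r'') = 0`, hence `r'' ∥ r`, and the curve becomes a geodesic
(`IsCurveInPlane.exists_geodesic_reparametrization`). So a nonconstant geodesic that cannot be
extended is already a maximal curve in its plane (`IsGeodesicOn.isMaximalCurveInPlane`), and the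
hypothesis applies to it.

The hypothesis gives a change of parameter `φ` from `ℝ` onto the domain `I` of the geodesic. For `r
∘ φ` the determinant is `φ' C`, so `|φ'|` is bounded below by a positive constant, `φ` is onto `ℝ`,
and `I = ℝ`. -/

noncomputable section

namespace AffineHypersurface

/-! ### Gauss formula along a curve -/

section AlongCurve

variable {n : ℕ} {M : Type*} [TopologicalSpace M] [ChartedSpace (EuclideanSpace ℝ (Fin n)) M]
  {f ξ : M → EuclideanSpace ℝ (Fin (n + 1))}

/-- The chain rule for a vector valued function along a curve. -/
theorem hasDerivAt_comp_curve {V : Type*} [NormedAddCommGroup V] [NormedSpace ℝ V] {F : M → V}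
    {γ : ℝ → M} {t : ℝ} (hF : MDifferentiableAt (𝓡 n) 𝓘(ℝ, V) F (γ t))
    (hγ : MDifferentiableAt 𝓘(ℝ, ℝ) (𝓡 n) γ t) :
    HasDerivAt (fun s => F (γ s)) (mvfderiv (𝓡 n) F (γ t) (velocity n γ t)) t := by
  have h2 := (hF.comp t hγ).hasMFDerivAt
  rw [mfderiv_comp t hF hγ] at h2
  let L : ℝ →L[ℝ] V := (mvfderiv (𝓡 n) F (γ t)).comp (mfderiv 𝓘(ℝ, ℝ) (𝓡 n) γ t)
  have h4 : HasFDerivAt (fun s => F (γ s)) L t := h2.hasFDerivAt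
  exact h4.hasDerivAt

/-- The derivative of `f` in the trivialization of the tangent bundle around `p`. -/
def localDifferential (f : M → EuclideanSpace ℝ (Fin (n + 1))) [IsManifold (𝓡 n) ∞ M] (p y : M) :
    EuclideanSpace ℝ (Fin n) →L[ℝ] EuclideanSpace ℝ (Fin (n + 1)) :=
  (mvfderiv (𝓡 n) f y).comp
    ((trivializationAt (EuclideanSpace ℝ (Fin n)) (TangentSpace (𝓡 n) : M → Type _) p).symmL ℝ y)

theorem localDifferential_apply [IsManifold (𝓡 n) ∞ M] {p y : M}
    (hy : y ∈ (trivializationAt (EuclideanSpace ℝ (Fin n))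
      (TangentSpace (𝓡 n) : M → Type _) p).baseSet) (a : EuclideanSpace ℝ (Fin n)) :
    localDifferential f p y a = mvfderiv (𝓡 n) f y
      ((trivializationAt (EuclideanSpace ℝ (Fin n)) (TangentSpace (𝓡 n) : M → Type _) p).symm
        y a) := by
  simp only [localDifferential, ContinuousLinearMap.comp_apply]
  rw [Bundle.Trivialization.symmL_apply _ hy]

theorem mdifferentiableAt_localDifferential [IsManifold (𝓡 n) ∞ M]
    (hf : ContMDiff (𝓡 n) 𝓘(ℝ, EuclideanSpace ℝ (Fin (n + 1))) ∞ f) (p : M) :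
    MDifferentiableAt (𝓡 n)
      𝓘(ℝ, EuclideanSpace ℝ (Fin n) →L[ℝ] EuclideanSpace ℝ (Fin (n + 1)))
      (localDifferential f p) p := by
  have h := (ContMDiffAt.mfderiv_const (m := 1) (hf p) (by norm_cast)).mdifferentiableAt
    one_ne_zero
  refine h.congr_of_eventuallyEq (Filter.Eventually.of_forall fun y => ?_)
  ext1 a
  simp only [inTangentCoordinates, ContinuousLinearMap.inCoordinates, localDifferential,
    ContinuousLinearMap.comp_apply]
  rw [TangentBundle.continuousLinearMapAt_model_space]
  rfl

/-- The velocity is the differential of `γ` applied to `1`, and the differential of a smooth map is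
smooth in tangent coordinates. -/
theorem differentiableAt_velocity_coord [IsManifold (𝓡 n) ∞ M] {γ : ℝ → M} {t : ℝ}
    (hγ : ContMDiffAt 𝓘(ℝ, ℝ) (𝓡 n) ∞ γ t) :
    DifferentiableAt ℝ (fun s : ℝ =>
        (trivializationAt (EuclideanSpace ℝ (Fin n)) (TangentSpace (𝓡 n) : M → Type _) (γ t)
          ⟨γ s, velocity n γ s⟩).2) t := by
  have h := (ContMDiffAt.mfderiv_const (m := 1) hγ (by norm_cast)).mdifferentiableAt
    one_ne_zero
  have h2 := h.differentiableAt.clm_apply (differentiableAt_const (1 : ℝ))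
  set e := trivializationAt (EuclideanSpace ℝ (Fin n)) (TangentSpace (𝓡 n) : M → Type _) (γ t)
  refine h2.congr_of_eventuallyEq ?_
  filter_upwards [hγ.continuousAt.eventually (e.open_baseSet.mem_nhds
      (FiberBundle.mem_baseSet_trivializationAt' (γ t)))] with s hs
  simp only [inTangentCoordinates, ContinuousLinearMap.inCoordinates,
    ContinuousLinearMap.comp_apply]
  rw [TangentBundle.symmL_model_space, Bundle.Trivialization.continuousLinearMapAt_apply,
    Bundle.Trivialization.coe_linearMapAt_of_mem _ hs]
  rfl

/-- The Gauss formula along a curve. -/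
theorem exists_hasDerivAt_gauss [IsManifold (𝓡 n) ∞ M] (h : IsTransversalField f ξ)
    {γ : ℝ → M} {t : ℝ} (hγ : ContMDiffAt 𝓘(ℝ, ℝ) (𝓡 n) ∞ γ t) :
    ∃ s : ℝ, HasDerivAt (fun u => mvfderiv (𝓡 n) f (γ u) (velocity n γ u))
      (mvfderiv (𝓡 n) f (γ t) (covariantDerivAlong (inducedConnection h) γ (velocity n γ) t)
        + s • ξ (γ t)) t := by
  have hf := h.smooth_immersion
  set e := trivializationAt (EuclideanSpace ℝ (Fin n)) (TangentSpace (𝓡 n) : M → Type _) (γ t)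
    with he
  set a : ℝ → EuclideanSpace ℝ (Fin n) := fun s => (e ⟨γ s, velocity n γ s⟩).2 with ha
  have hbase : ∀ᶠ u in nhds t, γ u ∈ e.baseSet :=
    hγ.continuousAt.eventually (e.open_baseSet.mem_nhds
      (FiberBundle.mem_baseSet_trivializationAt' (γ t)))
  have hda : HasDerivAt a (deriv a t) t := (differentiableAt_velocity_coord hγ).hasDerivAt
  have hγd : MDifferentiableAt 𝓘(ℝ, ℝ) (𝓡 n) γ t := hγ.mdifferentiableAt (by simp)
  have hL := mdifferentiableAt_localDifferential hf (γ t)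
  have hLγ : HasDerivAt (fun u => localDifferential f (γ t) (γ u))
      (mvfderiv (𝓡 n) (localDifferential f (γ t)) (γ t) (velocity n γ t)) t :=
    hasDerivAt_comp_curve hL hγd
  -- Near `t`, `f_* γ'` is the local differential along `γ` applied to the coordinates `a` of `γ'`.
  -- The product rule yields the two summands that define the covariant derivative.
  have hsum := hLγ.clm_apply hda
  obtain ⟨s, hs⟩ := gauss_formula h
    (FiberBundle.extend (EuclideanSpace ℝ (Fin n)) (velocity n γ t)) (γ t) (velocity n γ t)
  have hp : γ t ∈ e.baseSet := FiberBundle.mem_baseSet_trivializationAt' (γ t)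
  have hext : (fun y => mvfderiv (𝓡 n) f y
      (FiberBundle.extend (EuclideanSpace ℝ (Fin n)) (velocity n γ t) y))
      =ᶠ[nhds (γ t)] fun y => localDifferential f (γ t) y (a t) := by
    filter_upwards [e.open_baseSet.mem_nhds hp] with y hy
    exact (localDifferential_apply hy _).symm
  -- Both sides are the derivative at `t`, along `γ`, of the push-forward of the local field with
  -- constant coefficients `a t`.
  have hcomp : mvfderiv (𝓡 n) (fun y => mvfderiv (𝓡 n) f y
      (FiberBundle.extend (EuclideanSpace ℝ (Fin n)) (velocity n γ t) y)) (γ t)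
      (velocity n γ t)
      = mvfderiv (𝓡 n) (localDifferential f (γ t)) (γ t) (velocity n γ t) (a t) := by
    have h0 : MDifferentiableAt (𝓡 n) 𝓘(ℝ, EuclideanSpace ℝ (Fin (n + 1)))
        (fun y => localDifferential f (γ t) y (a t)) (γ t) :=
      hL.clm_apply mdifferentiableAt_const
    have h1 := hasDerivAt_comp_curve (h0.congr_of_eventuallyEq hext) hγd
    have h2 := (hLγ.clm_apply (hasDerivAt_const t (a t))).congr_of_eventuallyEq
      (hγ.continuousAt.eventually hext)
    refine h1.unique (h2.congr_deriv ?_)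
    simp
  refine ⟨s, ?_⟩
  have hval : mvfderiv (𝓡 n) f (γ t)
      (covariantDerivAlong (inducedConnection h) γ (velocity n γ) t) + s • ξ (γ t)
      = mvfderiv (𝓡 n) (localDifferential f (γ t)) (γ t) (velocity n γ t) (a t)
        + localDifferential f (γ t) (γ t) (deriv a t) := by
    rw [← hcomp, hs]
    simp only [covariantDerivAlong, map_add]
    rw [localDifferential_apply hp]
    abel
  rw [hval]
  refine hsum.congr_of_eventuallyEq ?_
  filter_upwards [hbase] with u hu
  rw [localDifferential_apply hu]
  congr 1
  exact (e.symm_apply_apply_mk hu _).symm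

end AlongCurve
-- Geodesics via the position vector; maximal geodesics
section CentroaffineGeodesic

variable {n : ℕ} {M : Type*} [TopologicalSpace M] [ChartedSpace (EuclideanSpace ℝ (Fin n)) M]
  {f ξ : M → EuclideanSpace ℝ (Fin (n + 1))}

theorem IsCentroaffineNormalization.eq_zero_of_add_smul_eq_zero
    (h : IsCentroaffineNormalization f ξ) {x : M} {u : TangentSpace (𝓡 n) x} {s : ℝ}
    (hus : mvfderiv (𝓡 n) f x u + s • f x = 0) : u = 0 ∧ s = 0 := by
  obtain ⟨hT, c, hc, hξ⟩ := h
  have h1 : splitMap f ξ x (u, s * c⁻¹) = 0 := by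
    simp only [splitMap, LinearMap.coprod_apply, LinearMap.toSpanSingleton_apply, hξ, smul_smul,
      mul_assoc, inv_mul_cancel₀ hc, mul_one]
    exact hus
  have h2 := (injective_iff_map_eq_zero _).1 (splitMap_bijective hT x).1 _ h1
  rw [Prod.mk_eq_zero] at h2
  exact ⟨h2.1, by simpa [hc] using h2.2⟩

theorem hasDerivAt_position {γ : ℝ → M} {I : Set ℝ} (h : IsTransversalField f ξ)
    (hI : IsOpen I) (hγ : ContMDiffOn 𝓘(ℝ, ℝ) (𝓡 n) ∞ γ I) {t : ℝ} (ht : t ∈ I) :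
    HasDerivAt (fun s => f (γ s)) (mvfderiv (𝓡 n) f (γ t) (velocity n γ t)) t :=
  hasDerivAt_comp_curve ((h.smooth_immersion.mdifferentiable (by simp)) _)
    (((hγ t ht).contMDiffAt (hI.mem_nhds ht)).mdifferentiableAt (by simp))

theorem contDiffOn_position {γ : ℝ → M} {I : Set ℝ} (h : IsTransversalField f ξ)
    (hγ : ContMDiffOn 𝓘(ℝ, ℝ) (𝓡 n) ∞ γ I) : ContDiffOn ℝ ∞ (fun s => f (γ s)) I :=
  (h.smooth_immersion.comp_contMDiffOn hγ).contDiffOn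

/-- For a centroaffine normalization, geodesics are the curves with acceleration proportional to
the position vector. -/
theorem covariantDerivAlong_velocity_eq_zero_iff [IsManifold (𝓡 n) ∞ M]
    (h : IsCentroaffineNormalization f ξ) {γ : ℝ → M} {I : Set ℝ} (hI : IsOpen I)
    (hγ : ContMDiffOn 𝓘(ℝ, ℝ) (𝓡 n) ∞ γ I) {t : ℝ} (ht : t ∈ I) :
    covariantDerivAlong (inducedConnection h.1) γ (velocity n γ) t = 0 ↔
      ∃ s : ℝ, deriv (deriv fun u => f (γ u)) t = s • f (γ t) := by
  obtain ⟨s, hs⟩ := exists_hasDerivAt_gauss h.1 ((hγ t ht).contMDiffAt (hI.mem_nhds ht))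
  obtain ⟨c, hc, hξ⟩ := h.2
  have he : deriv (fun u => f (γ u))
      =ᶠ[nhds t] fun u => mvfderiv (𝓡 n) f (γ u) (velocity n γ u) := by
    filter_upwards [hI.mem_nhds ht] with u hu
    exact (hasDerivAt_position h.1 hI hγ hu).deriv
  rw [(hs.congr_of_eventuallyEq he).deriv, hξ]
  constructor
  · intro h0
    exact ⟨s * c, by rw [h0, map_zero, zero_add, smul_smul]⟩
  · rintro ⟨s', hs'⟩
    -- The two expressions for the acceleration differ by a tangent vector plus a multiple of `f`,
    -- so transversality kills the tangent vector.
    refine (h.eq_zero_of_add_smul_eq_zero (s := s * c - s') ?_).1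
    rw [sub_smul, ← hs', mul_smul]
    abel

/-- From here on the covariant derivative enters only through this condition on the position vector.
-/
theorem isGeodesicOn_iff [IsManifold (𝓡 n) ∞ M] (h : IsCentroaffineNormalization f ξ)
    {γ : ℝ → M} {I : Set ℝ} :
    IsGeodesicOn (inducedConnection h.1) γ I ↔
      IsOpen I ∧ I.OrdConnected ∧ I.Nonempty ∧ ContMDiffOn 𝓘(ℝ, ℝ) (𝓡 n) ∞ γ I ∧
        ∀ t ∈ I, ∃ s : ℝ, deriv (deriv fun u => f (γ u)) t = s • f (γ t) := by
  constructor
  · rintro ⟨h1, h2, h3, h4, h5⟩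
    exact ⟨h1, h2, h3, h4, fun t ht =>
      (covariantDerivAlong_velocity_eq_zero_iff h h1 h4 ht).1 (h5 t ht)⟩
  · rintro ⟨h1, h2, h3, h4, h5⟩
    exact ⟨h1, h2, h3, h4, fun t ht =>
      (covariantDerivAlong_velocity_eq_zero_iff h h1 h4 ht).2 (h5 t ht)⟩

/-- A constant curve is a geodesic. -/
theorem isGeodesicOn_const [IsManifold (𝓡 n) ∞ M] (h : IsCentroaffineNormalization f ξ) (x : M) :
    IsGeodesicOn (inducedConnection h.1) (fun _ => x) Set.univ := by
  rw [isGeodesicOn_iff h]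
  refine ⟨isOpen_univ, Set.ordConnected_univ, Set.univ_nonempty, contMDiffOn_const,
    fun t _ => ⟨0, ?_⟩⟩
  simp

/-- Every geodesic extends to one that is not the restriction of another. -/
theorem exists_maximal_geodesic [IsManifold (𝓡 n) ∞ M] (h : IsCentroaffineNormalization f ξ)
    {γ₀ : ℝ → M} {I₀ : Set ℝ} (h₀ : IsGeodesicOn (inducedConnection h.1) γ₀ I₀) :
    ∃ (γ : ℝ → M) (I : Set ℝ), IsGeodesicOn (inducedConnection h.1) γ I ∧ I₀ ⊆ I ∧
      Set.EqOn γ γ₀ I₀ ∧ ∀ (σ : ℝ → M) (J : Set ℝ), IsGeodesicOn (inducedConnection h.1) σ J →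
        I ⊆ J → Set.EqOn γ σ I → J ⊆ I := by
  let S := {p : (ℝ → M) × Set ℝ //
    IsGeodesicOn (inducedConnection h.1) p.1 p.2 ∧ I₀ ⊆ p.2 ∧ Set.EqOn p.1 γ₀ I₀}
  -- Zorn's lemma. The order compares values as well as domains, so the members of a chain glue
  -- without any uniqueness theorem for geodesics.
  let r : S → S → Prop := fun p q => p.1.2 ⊆ q.1.2 ∧ Set.EqOn p.1.1 q.1.1 p.1.2
  obtain ⟨m, hm⟩ := exists_maximal_of_chains_bounded (r := r) (by
    intro c hc
    rcases c.eq_empty_or_nonempty with rfl | ⟨p₀, hp₀⟩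
    · exact ⟨⟨(γ₀, I₀), h₀, subset_rfl, fun _ _ => rfl⟩, by simp⟩
    set U : Set ℝ := ⋃ p ∈ c, p.1.2 with hU
    have hex : ∀ t, ∃ x : M, ∀ p ∈ c, t ∈ p.1.2 → p.1.1 t = x := by
      intro t
      by_cases ht : ∃ p ∈ c, t ∈ p.1.2
      · obtain ⟨p, hp, htp⟩ := ht
        refine ⟨p.1.1 t, fun q hq htq => ?_⟩
        rcases eq_or_ne p q with rfl | hne
        · rfl
        rcases hc hp hq hne with hr | hr
        · exact (hr.2 htp).symm
        · exact hr.2 htq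
      · push Not at ht
        exact ⟨γ₀ t, fun p hp htp => absurd htp (ht p hp)⟩
    choose g hg using hex
    have hloc : ∀ p ∈ c, ∀ t ∈ p.1.2, g =ᶠ[nhds t] p.1.1 := by
      intro p hp t ht
      filter_upwards [p.2.1.isOpen.mem_nhds ht] with s hs
      exact (hg s p hp hs).symm
    have hgeo : IsGeodesicOn (inducedConnection h.1) g U := by
      rw [isGeodesicOn_iff h]
      refine ⟨isOpen_biUnion fun p _ => p.2.1.isOpen, ?_, ?_, ?_, ?_⟩
      · rw [← isPreconnected_iff_ordConnected]
        obtain ⟨t₀, ht₀⟩ := h₀.nonempty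
        rw [hU, Set.biUnion_eq_iUnion]
        refine isPreconnected_iUnion ⟨t₀, Set.mem_iInter.2 fun p => p.1.2.2.1 ht₀⟩ fun p => ?_
        exact isPreconnected_iff_ordConnected.2 p.1.2.1.ordConnected
      · obtain ⟨t₀, ht₀⟩ := p₀.2.1.nonempty
        exact ⟨t₀, Set.mem_biUnion hp₀ ht₀⟩
      · intro t ht
        obtain ⟨p, hp, htp⟩ := Set.mem_iUnion₂.1 ht
        exact (((p.2.1.smooth t htp).contMDiffAt (p.2.1.isOpen.mem_nhds htp)).congr_of_eventuallyEq
          (hloc p hp t htp)).contMDiffWithinAt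
      · intro t ht
        obtain ⟨p, hp, htp⟩ := Set.mem_iUnion₂.1 ht
        have he : (fun u => f (g u)) =ᶠ[nhds t] fun u => f (p.1.1 u) :=
          (hloc p hp t htp).fun_comp f
        rw [he.deriv.deriv_eq, (hloc p hp t htp).eq_of_nhds]
        exact ((isGeodesicOn_iff h).1 p.2.1).2.2.2.2 t htp
    refine ⟨⟨(g, U), hgeo, fun t ht => Set.mem_biUnion hp₀ (p₀.2.2.1 ht), fun t ht => ?_⟩,
      fun p hp => ⟨fun t ht => Set.mem_biUnion hp ht, fun t ht => hg t p hp ht⟩⟩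
    exact ((hg t p₀ hp₀ (p₀.2.2.1 ht)).symm).trans (p₀.2.2.2 ht))
    (fun {a b c} hab hbc => ⟨hab.1.trans hbc.1, fun t ht => (hab.2 ht).trans (hbc.2 (hab.1 ht))⟩)
  refine ⟨m.1.1, m.1.2, m.2.1, m.2.2.1, m.2.2.2, fun σ J hσ hJ he => ?_⟩
  exact (hm ⟨(σ, J), hσ, m.2.2.1.trans hJ, fun t ht =>
    (he (m.2.2.1 ht)).symm.trans (m.2.2.2 ht)⟩ ⟨hJ, he⟩).1

end CentroaffineGeodesic
-- Constancy of the bivector `r ∧ r'`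
section Calculus

open scoped RealInnerProductSpace

variable {V : Type*} [NormedAddCommGroup V] [NormedSpace ℝ V]

theorem hasDerivAt_of_contDiffOn {r : ℝ → V} {I : Set ℝ} (hI : IsOpen I)
    (hr : ContDiffOn ℝ ∞ r I) {t : ℝ} (ht : t ∈ I) :
    HasDerivAt r (deriv r t) t :=
  ((hr.contDiffAt (hI.mem_nhds ht)).differentiableAt (by simp)).hasDerivAt

theorem contDiffOn_deriv {r : ℝ → V} {I : Set ℝ} (hI : IsOpen I)
    (hr : ContDiffOn ℝ ∞ r I) : ContDiffOn ℝ ∞ (deriv r) I :=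
  hr.deriv_of_isOpen hI (by simp)

theorem eq_of_hasDerivAt_zero {g : ℝ → V} {I : Set ℝ} (hI : IsOpen I) (hI' : I.OrdConnected)
    (hg : ∀ t ∈ I, HasDerivAt g 0 t) {t u : ℝ} (ht : t ∈ I) (hu : u ∈ I) : g t = g u :=
  hI.is_const_of_deriv_eq_zero hI'.isPreconnected
    (fun x hx => (hg x hx).differentiableAt.differentiableWithinAt)
    (fun x hx => (hg x hx).deriv) ht hu

/-- If `r'' ∥ r`, then the contractions of the bivector `r ∧ r'` are constant. -/
theorem inner_smul_deriv_sub_eq {E : Type*} [NormedAddCommGroup E] [InnerProductSpace ℝ E]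
    {r : ℝ → E} {I : Set ℝ} (hI : IsOpen I) (hI' : I.OrdConnected) (hr : ContDiffOn ℝ ∞ r I)
    (hr2 : ∀ t ∈ I, ∃ s : ℝ, deriv (deriv r) t = s • r t) (a : E) {t u : ℝ}
    (ht : t ∈ I) (hu : u ∈ I) :
    ⟪a, r t⟫ • deriv r t - ⟪a, deriv r t⟫ • r t
      = ⟪a, r u⟫ • deriv r u - ⟪a, deriv r u⟫ • r u := by
  refine eq_of_hasDerivAt_zero (g := fun t => ⟪a, r t⟫ • deriv r t - ⟪a, deriv r t⟫ • r t)
    hI hI' (fun x hx => ?_) ht hu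
  have h1 := hasDerivAt_of_contDiffOn hI hr hx
  have h2 := hasDerivAt_of_contDiffOn hI (contDiffOn_deriv hI hr) hx
  obtain ⟨s, hs⟩ := hr2 x hx
  rw [hs] at h2
  -- The terms `⟪a, r'⟫ r'` cancel, and so do the remaining two after substituting `r'' = s r`.
  have h3 := (((hasDerivAt_const x a).inner ℝ h1).smul h2).sub
    (((hasDerivAt_const x a).inner ℝ h2).smul h1)
  refine h3.congr_deriv ?_
  simp only [inner_zero_left, add_zero, inner_smul_right, smul_smul]
  rw [mul_comm s]
  abel

end Calculus

/-! ### Constant geodesics, and planarity of the others -/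

section Geodesic

open scoped RealInnerProductSpace

variable {n : ℕ} {M : Type*} [TopologicalSpace M] [ChartedSpace (EuclideanSpace ℝ (Fin n)) M]
  {f ξ : M → EuclideanSpace ℝ (Fin (n + 1))}

/-- The derivative is a nonzero tangent vector, while the position vector is transversal. -/
theorem linearIndependent_position_deriv (h : IsCentroaffineNormalization f ξ)
    {γ : ℝ → M} {I : Set ℝ} (hI : IsOpen I) (hγ : ContMDiffOn 𝓘(ℝ, ℝ) (𝓡 n) ∞ γ I) {t : ℝ}
    (ht : t ∈ I) (hv : velocity n γ t ≠ 0) :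
    LinearIndependent ℝ ![f (γ t), deriv (fun s => f (γ s)) t] := by
  rw [(hasDerivAt_position h.1 hI hγ ht).deriv, LinearIndependent.pair_iff]
  intro a b hab
  have h1 := h.eq_zero_of_add_smul_eq_zero (x := γ t) (u := b • velocity n γ t) (s := a)
    (by rw [map_smul]; exact (add_comm _ _).trans hab)
  exact ⟨h1.2, (smul_eq_zero.1 h1.1).resolve_right hv⟩

theorem position_ne_zero (h : IsCentroaffineNormalization f ξ) (x : M) : f x ≠ 0 := by
  intro h0
  have := (h.eq_zero_of_add_smul_eq_zero (x := x) (u := 0) (s := 1) (by simp [h0])).2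
  exact one_ne_zero this

/-- A geodesic with vanishing velocity at one point has vanishing velocity everywhere. -/
theorem IsGeodesicOn.velocity_eq_zero [IsManifold (𝓡 n) ∞ M]
    (h : IsCentroaffineNormalization f ξ) {γ : ℝ → M} {I : Set ℝ}
    (hγ : IsGeodesicOn (inducedConnection h.1) γ I) {t u : ℝ} (ht : t ∈ I) (hu : u ∈ I)
    (h0 : velocity n γ t = 0) : velocity n γ u = 0 := by
  by_contra hv
  obtain ⟨hI, hI', -, hs, hg⟩ := (isGeodesicOn_iff h).1 hγ
  have hli := linearIndependent_position_deriv h hI hs hu hv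
  -- Contract with `a = f (γ u)`. The contraction vanishes at `t`, and at `u` this reads `⟪r, r⟫ r'
  -- = ⟪r, r'⟫ r`, contradicting independence because `r ≠ 0`.
  have h1 := inner_smul_deriv_sub_eq hI hI' (contDiffOn_position h.1 hs) hg (f (γ u)) ht hu
  rw [(hasDerivAt_position h.1 hI hs ht).deriv, h0] at h1
  simp only [map_zero, smul_zero, inner_zero_right, zero_smul, sub_zero] at h1
  have h2 := LinearIndependent.pair_iff.1 hli
    (-⟪f (γ u), deriv (fun s => f (γ s)) u⟫) ⟪f (γ u), f (γ u)⟫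
    (by rw [h1]; module)
  exact position_ne_zero h (γ u) (inner_self_eq_zero.1 h2.2)

/-- A geodesic with vanishing velocity is constant. -/
theorem eq_of_velocity_eq_zero [IsManifold (𝓡 n) ∞ M] {γ : ℝ → M} {I : Set ℝ}
    (hI : IsOpen I) (hI' : I.OrdConnected) (hγ : ContMDiffOn 𝓘(ℝ, ℝ) (𝓡 n) ∞ γ I)
    (h0 : ∀ t ∈ I, velocity n γ t = 0) {t u : ℝ} (ht : t ∈ I) (hu : u ∈ I) : γ t = γ u := by
  have hγ' : ∀ t ∈ I, ContMDiffAt 𝓘(ℝ, ℝ) (𝓡 n) ∞ γ t := fun t ht =>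
    (hγ t ht).contMDiffAt (hI.mem_nhds ht)
  have hloc : IsLocallyConstant (I.domRestrict γ) := by
    rw [IsLocallyConstant.iff_eventually_eq]
    rintro ⟨x, hx⟩
    have hn : I ∩ γ ⁻¹' (extChartAt (𝓡 n) (γ x)).source ∈ nhds x :=
      Filter.inter_mem (hI.mem_nhds hx) ((hγ' x hx).continuousAt
        (extChartAt_source_mem_nhds (γ x)))
    obtain ⟨ε, hε, hball⟩ := Metric.mem_nhds_iff.1 hn
    have hev : ∀ y ∈ Metric.ball x ε, γ y = γ x := by
      intro y hy
      have hxb : x ∈ Metric.ball x ε := Metric.mem_ball_self hε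
      refine (extChartAt (𝓡 n) (γ x)).injOn (hball hy).2 (hball hxb).2 ?_
      refine eq_of_hasDerivAt_zero (g := fun s => extChartAt (𝓡 n) (γ x) (γ s))
        Metric.isOpen_ball (convex_ball x ε).ordConnected (fun z hz => ?_) hy hxb
      have h1 := hasDerivAt_comp_curve
        (mdifferentiableAt_extChartAt (I := 𝓡 n) (x := γ x) (y := γ z)
          (by simpa using (hball hz).2))
        ((hγ' z (hball hz).1).mdifferentiableAt (by simp))
      rw [h0 z (hball hz).1, map_zero] at h1
      exact h1
    have : ∀ᶠ y in nhds x, γ y = γ x :=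
      Filter.mem_of_superset (Metric.ball_mem_nhds x hε) hev
    exact (continuous_subtype_val (p := (· ∈ I))).continuousAt (x := ⟨x, hx⟩) |>.eventually this
  have : PreconnectedSpace I := Subtype.preconnectedSpace hI'.isPreconnected
  exact hloc.apply_eq_of_preconnectedSpace ⟨t, ht⟩ ⟨u, hu⟩

/-- A geodesic stays in the plane spanned by its position and velocity at one point. -/
theorem IsGeodesicOn.mem_span [IsManifold (𝓡 n) ∞ M]
    (h : IsCentroaffineNormalization f ξ) {γ : ℝ → M} {I : Set ℝ}
    (hγ : IsGeodesicOn (inducedConnection h.1) γ I) (hv : ∀ t ∈ I, velocity n γ t ≠ 0)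
    {t u : ℝ} (ht : t ∈ I) (hu : u ∈ I) :
    f (γ u) ∈ Submodule.span ℝ (Set.range ![f (γ t), deriv (fun s => f (γ s)) t]) := by
  obtain ⟨hI, hI', -, hs, hg⟩ := (isGeodesicOn_iff h).1 hγ
  rw [← Submodule.orthogonal_orthogonal (Submodule.span ℝ _), Submodule.mem_orthogonal]
  intro a ha
  rw [Submodule.mem_orthogonal'] at ha
  have ha0 := ha _ (Submodule.subset_span ⟨0, rfl⟩)
  have ha1 := ha _ (Submodule.subset_span ⟨1, rfl⟩)
  simp only [Matrix.cons_val_zero, Matrix.cons_val_one] at ha0 ha1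
  -- For `a` orthogonal to the span the contraction vanishes at `t`, hence at `u`, where
  -- independence of `r` and `r'` forces `⟪a, r⟫ = 0`.
  have h1 := inner_smul_deriv_sub_eq hI hI' (contDiffOn_position h.1 hs) hg a hu ht
  rw [ha0, ha1, zero_smul, zero_smul, sub_zero] at h1
  have hli := linearIndependent_position_deriv h hI hs hu (hv u hu)
  exact (LinearIndependent.pair_iff.1 hli (-⟪a, deriv (fun s => f (γ s)) u⟫) ⟪a, f (γ u)⟫
    (by rw [← h1]; module)).2

end Geodesic
-- Primitives and smooth inverses on intervals
section Reparametrization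

/-- A smooth function on an open interval has a primitive there. -/
theorem exists_primitive {w : ℝ → ℝ} {J : Set ℝ} (hJ : IsOpen J) (hJ' : J.OrdConnected)
    (hw : ContinuousOn w J) {u₀ : ℝ} (hu₀ : u₀ ∈ J) :
    ∃ ψ : ℝ → ℝ, ∀ u ∈ J, HasDerivAt ψ (w u) u := by
  refine ⟨fun u => ∫ x in u₀..u, w x, fun u hu => ?_⟩
  refine intervalIntegral.integral_hasDerivAt_right ?_ ?_ (hw.continuousAt (hJ.mem_nhds hu))
  · exact (hw.mono (hJ'.uIcc_subset hu₀ hu)).intervalIntegrable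
  · exact hw.stronglyMeasurableAtFilter hJ u hu

/-- The inverse function theorem for a smooth function without critical points on an open
interval. -/
theorem exists_smooth_inverse {ψ w : ℝ → ℝ} {J : Set ℝ} (hJ : IsOpen J) (hJ' : J.OrdConnected)
    (hw : ContDiffOn ℝ ∞ w J) (hw0 : ∀ u ∈ J, w u ≠ 0) (hψ : ∀ u ∈ J, HasDerivAt ψ (w u) u) :
    ∃ τ : ℝ → ℝ, IsOpen (ψ '' J) ∧ (ψ '' J).OrdConnected ∧ (∀ u ∈ J, τ (ψ u) = u) ∧
      ContDiffOn ℝ ∞ τ (ψ '' J) ∧ ∀ u ∈ J, HasDerivAt τ (w u)⁻¹ (ψ u) := by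
  have hsmooth : ContDiffOn ℝ ∞ ψ J := by
    rw [contDiffOn_infty_iff_deriv_of_isOpen hJ]
    exact ⟨fun u hu => (hψ u hu).differentiableAt.differentiableWithinAt,
      hw.congr fun u hu => (hψ u hu).deriv⟩
  -- By Rolle's theorem, two equal values would produce a zero of `w`.
  have hinj : Set.InjOn ψ J := by
    have key : ∀ a ∈ J, ∀ b ∈ J, a < b → ψ a ≠ ψ b := by
      intro a ha b hb hab heq
      have hsub : Set.Icc a b ⊆ J := hJ'.out ha hb
      obtain ⟨c, hc, hc0⟩ := exists_hasDerivAt_eq_zero hab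
        (hsmooth.continuousOn.mono hsub) heq
        (fun x hx => hψ x (hsub (Set.Ioo_subset_Icc_self hx)))
      exact hw0 c (hsub (Set.Ioo_subset_Icc_self hc)) hc0
    intro a ha b hb heq
    rcases lt_trichotomy a b with hab | hab | hab
    · exact absurd heq (key a ha b hb hab)
    · exact hab
    · exact absurd heq.symm (key b hb a ha hab)
  set τ := Function.invFunOn ψ J with hτ
  have hleft : ∀ u ∈ J, τ (ψ u) = u := fun u hu => hinj.leftInvOn_invFunOn hu
  have hloc : ∀ u ∈ J, ψ '' J ∈ nhds (ψ u) ∧ ContDiffAt ℝ ∞ τ (ψ u) ∧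
      HasDerivAt τ (w u)⁻¹ (ψ u) := by
    intro u hu
    have hc : ContDiffAt ℝ ∞ ψ u := hsmooth.contDiffAt (hJ.mem_nhds hu)
    let L : ℝ ≃L[ℝ] ℝ := ContinuousLinearEquiv.unitsEquivAut ℝ (Units.mk0 (w u) (hw0 u hu))
    have hL : HasFDerivAt ψ (L : ℝ →L[ℝ] ℝ) u := (hψ u hu).hasFDerivAt_equiv (hw0 u hu)
    have h1 := hc.to_localInverse hL (by simp)
    set e := hc.localInverse hL (by simp) with he
    have hs : HasStrictFDerivAt ψ (L : ℝ →L[ℝ] ℝ) u := hc.hasStrictFDerivAt' hL (by simp)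
    have hright : ∀ᶠ y in nhds (ψ u), ψ (e y) = y := hs.eventually_right_inverse
    have heu : e (ψ u) = u := hs.localInverse_apply_image
    have hmem : ∀ᶠ y in nhds (ψ u), e y ∈ J :=
      h1.continuousAt.eventually (heu.symm ▸ hJ.mem_nhds hu)
    -- By injectivity the global inverse agrees with each local inverse, and so inherits its
    -- smoothness.
    have heq : τ =ᶠ[nhds (ψ u)] e := by
      filter_upwards [hright, hmem] with y hy1 hy2
      rw [← hleft (e y) hy2, hy1]
    refine ⟨?_, h1.congr_of_eventuallyEq heq, ?_⟩
    · filter_upwards [hright, hmem] with y hy1 hy2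
      exact ⟨e y, hy2, hy1⟩
    · have h2 := (h1.congr_of_eventuallyEq heq).continuousAt
      refine HasDerivAt.of_local_left_inverse h2 (by rw [hleft u hu]; exact hψ u hu)
        (hw0 u hu) ?_
      filter_upwards [heq, hright] with y hy1 hy2
      rw [hy1, hy2]
  refine ⟨τ, ?_, ?_, hleft, ?_, fun u hu => (hloc u hu).2.2⟩
  · rw [isOpen_iff_mem_nhds]
    rintro _ ⟨u, hu, rfl⟩
    exact (hloc u hu).1
  · exact (hJ'.isPreconnected.image ψ hsmooth.continuousOn).ordConnected
  · rintro _ ⟨u, hu, rfl⟩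
    exact (hloc u hu).2.1.contDiffWithinAt

end Reparametrization

/-! ### Determinants on a plane -/

section PlaneForm

variable {E : Type*} [NormedAddCommGroup E] [InnerProductSpace ℝ E] [FiniteDimensional ℝ E]

/-- A determinant on a subspace extends to an alternating bilinear form on the whole space. -/
theorem exists_extension_of_det {π : Submodule ℝ E} (d : π [⋀^Fin 2]→ₗ[ℝ] ℝ) :
    ∃ Ω : E →L[ℝ] E →L[ℝ] ℝ, (∀ u, Ω u u = 0) ∧ ∀ u v : π, Ω u v = d ![u, v] := by
  have h0 (a b c : π) : Function.update ![a, b] 0 c = ![c, b] := by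
    ext i; fin_cases i <;> rfl
  have h1 (a b c : π) : Function.update ![a, b] 1 c = ![a, c] := by
    ext i; fin_cases i <;> rfl
  -- Pulling back by the orthogonal projection gives a form on the ambient space, which can be
  -- differentiated along curves there.
  let P := π.orthogonalProjectionOnto
  let B : E →ₗ[ℝ] E →ₗ[ℝ] ℝ := LinearMap.mk₂ ℝ (fun u v => d ![P u, P v])
    (fun u u' v => by
      have := d.map_update_add ![P u, P v] 0 (P u) (P u')
      simpa only [map_add, map_smul, h0, h1, smul_eq_mul] using this)
    (fun c u v => by
      have := d.map_update_smul ![P u, P v] 0 c (P u)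
      simpa only [map_add, map_smul, h0, h1, smul_eq_mul] using this)
    (fun u v v' => by
      have := d.map_update_add ![P u, P v] 1 (P v) (P v')
      simpa only [map_add, map_smul, h0, h1, smul_eq_mul] using this)
    (fun c u v => by
      have := d.map_update_smul ![P u, P v] 1 c (P v)
      simpa only [map_add, map_smul, h0, h1, smul_eq_mul] using this)
  refine ⟨LinearMap.toContinuousLinearMap
    ((LinearMap.toContinuousLinearMap : (E →ₗ[ℝ] ℝ) ≃ₗ[ℝ] E →L[ℝ] ℝ).toLinearMap ∘ₗ B), ?_, ?_⟩
  · intro u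
    exact d.map_eq_zero_of_eq ![P u, P u] (i := 0) (j := 1) rfl (by decide)
  · intro u v
    change d ![P u, P v] = _
    simp [P]

-- In dimension two, an alternating form is its value on a basis times the determinant of that
-- basis.
omit [FiniteDimensional ℝ E] in
theorem det_ne_zero_of_linearIndependent {π : Submodule ℝ E} (hπ : Module.finrank ℝ π = 2)
    {d : π [⋀^Fin 2]→ₗ[ℝ] ℝ} (hd : d ≠ 0) {u v : π} (h : LinearIndependent ℝ ![u, v]) :
    d ![u, v] ≠ 0 := by
  intro h0
  have : Nonempty (Fin 2) := ⟨0⟩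
  let b := basisOfLinearIndependentOfCardEqFinrank h (by simp [hπ])
  apply hd
  rw [d.eq_smul_basis_det b]
  have hb : (b : Fin 2 → π) = ![u, v] := by simp [b]
  rw [hb, h0, zero_smul]

end PlaneForm
-- Plane curves as geodesics, and maximality
section MaximalCurve

variable {n : ℕ} {M : Type*} [TopologicalSpace M] [ChartedSpace (EuclideanSpace ℝ (Fin n)) M]
  {f ξ : M → EuclideanSpace ℝ (Fin (n + 1))}

/-- Pairing with any vector orthogonal to `π` gives a function that vanishes near `t`. -/
theorem deriv_mem_of_mem {E : Type*} [NormedAddCommGroup E] [InnerProductSpace ℝ E]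
    [FiniteDimensional ℝ E] {π : Submodule ℝ E} {r : ℝ → E} {r' : E} {I : Set ℝ} (hI : IsOpen I)
    (hr : ∀ t ∈ I, r t ∈ π) {t : ℝ} (ht : t ∈ I) (h : HasDerivAt r r' t) : r' ∈ π := by
  rw [← Submodule.orthogonal_orthogonal π, Submodule.mem_orthogonal]
  intro a ha
  have h1 := (hasDerivAt_const t a).inner ℝ h
  have h2 : (fun s => inner ℝ a (r s)) =ᶠ[nhds t] fun _ => (0 : ℝ) := by
    filter_upwards [hI.mem_nhds ht] with s hs
    exact (Submodule.mem_orthogonal' _ _).1 ha _ (hr s hs)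
  have h3 := h1.unique ((hasDerivAt_const t (0 : ℝ)).congr_of_eventuallyEq h2)
  simpa using h3

theorem form_ne_zero_iff_linearIndependent {E : Type*} [NormedAddCommGroup E]
    [InnerProductSpace ℝ E] {π : Submodule ℝ E} (hπ : Module.finrank ℝ π = 2)
    {d : π [⋀^Fin 2]→ₗ[ℝ] ℝ} (hd : d ≠ 0) {Ω : E →L[ℝ] E →L[ℝ] ℝ} (hΩ0 : ∀ u, Ω u u = 0)
    (hΩ : ∀ u v : π, Ω u v = d ![u, v]) {u v : E} (hu : u ∈ π) (hv : v ∈ π) :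
    Ω u v ≠ 0 ↔ LinearIndependent ℝ ![u, v] := by
  constructor
  · intro h
    rw [LinearIndependent.pair_iff' (by rintro rfl; simp at h)]
    rintro a rfl
    simp [hΩ0] at h
  · intro h
    rw [show Ω u v = d ![⟨u, hu⟩, ⟨v, hv⟩] from hΩ ⟨u, hu⟩ ⟨v, hv⟩]
    refine det_ne_zero_of_linearIndependent hπ hd ?_
    rw [LinearIndependent.pair_iff] at h ⊢
    intro a b hab
    exact h a b (by simpa using congrArg Subtype.val hab)

/-- The area form of position and velocity is constant along a geodesic. -/
theorem IsGeodesicOn.form_eq [IsManifold (𝓡 n) ∞ M] (h : IsCentroaffineNormalization f ξ)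
    {γ : ℝ → M} {I : Set ℝ} (hγ : IsGeodesicOn (inducedConnection h.1) γ I)
    {Ω : EuclideanSpace ℝ (Fin (n + 1)) →L[ℝ] EuclideanSpace ℝ (Fin (n + 1)) →L[ℝ] ℝ}
    (hΩ0 : ∀ u, Ω u u = 0) {t u : ℝ} (ht : t ∈ I) (hu : u ∈ I) :
    Ω (f (γ t)) (deriv (fun s => f (γ s)) t) = Ω (f (γ u)) (deriv (fun s => f (γ s)) u) := by
  obtain ⟨hI, hI', -, hs, hg⟩ := (isGeodesicOn_iff h).1 hγ
  have hr := contDiffOn_position h.1 hs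
  refine eq_of_hasDerivAt_zero
    (g := fun t => Ω (f (γ t)) (deriv (fun s => f (γ s)) t)) hI hI' (fun x hx => ?_) ht hu
  have h1 := hasDerivAt_of_contDiffOn hI hr hx
  have h2 := hasDerivAt_of_contDiffOn hI (contDiffOn_deriv hI hr) hx
  obtain ⟨s, hs⟩ := hg x hx
  rw [hs] at h2
  -- The derivative is `Ω(r', r') + s Ω(r, r)`, and both terms vanish.
  have h3 := (Ω.hasFDerivAt.comp_hasDerivAt x h1).clm_apply h2
  exact h3.congr_deriv (by simp [hΩ0])

/-- A curve in a plane has a reparametrization as a geodesic, with area form `C` of position and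
velocity. The inverse change of parameter `ψ` may be
shifted by any constant `b`. -/
theorem IsCurveInPlane.exists_geodesic_reparametrization [IsManifold (𝓡 n) ∞ M]
    (h : IsCentroaffineNormalization f ξ)
    {π : Submodule ℝ (EuclideanSpace ℝ (Fin (n + 1)))} (hπ : Module.finrank ℝ π = 2)
    {d : π [⋀^Fin 2]→ₗ[ℝ] ℝ} (hd : d ≠ 0)
    {Ω : EuclideanSpace ℝ (Fin (n + 1)) →L[ℝ] EuclideanSpace ℝ (Fin (n + 1)) →L[ℝ] ℝ}
    (hΩ0 : ∀ u, Ω u u = 0) (hΩ : ∀ u v : π, Ω u v = d ![u, v])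
    {σ : ℝ → M} {J : Set ℝ} (hσ : IsCurveInPlane f π σ J) {C : ℝ} (hC : C ≠ 0) :
    ∃ ψ : ℝ → ℝ, (∀ u ∈ J, HasDerivAt ψ
      (C⁻¹ * Ω (f (σ u)) (deriv (fun s => f (σ s)) u)) u) ∧ Set.InjOn ψ J ∧ ∀ b : ℝ,
      ∃ τ : ℝ → ℝ, (∀ u ∈ J, τ (ψ u + b) = u) ∧
        IsGeodesicOn (inducedConnection h.1) (σ ∘ τ) ((fun u => ψ u + b) '' J) := by
  obtain ⟨hJ, hJ', hne, hs, hreg, hmem⟩ := hσ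
  have hR := contDiffOn_position h.1 hs
  set R : ℝ → EuclideanSpace ℝ (Fin (n + 1)) := fun s => f (σ s) with hRdef
  have hR' := contDiffOn_deriv hJ hR
  have hdR : ∀ u ∈ J, HasDerivAt R (deriv R u) u := fun u hu => hasDerivAt_of_contDiffOn hJ hR hu
  have hmem' : ∀ u ∈ J, deriv R u ∈ π := fun u hu => deriv_mem_of_mem hJ hmem hu (hdR u hu)
  -- The new parameter `ψ` has `ψ' = w`. Velocities get divided by `w`, which turns `Ω(R, R')` into
  -- the constant `C`.
  set w : ℝ → ℝ := fun u => C⁻¹ * Ω (R u) (deriv R u) with hwdef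
  have hw : ContDiffOn ℝ ∞ w J :=
    contDiffOn_const.mul ((Ω.contDiff.comp_contDiffOn hR).clm_apply hR')
  have hw0 : ∀ u ∈ J, w u ≠ 0 := fun u hu => mul_ne_zero (inv_ne_zero hC)
    ((form_ne_zero_iff_linearIndependent hπ hd hΩ0 hΩ (hmem u hu) (hmem' u hu)).2
      (linearIndependent_position_deriv h hJ hs hu (hreg u hu)))
  obtain ⟨u₀, hu₀⟩ := hne
  obtain ⟨ψ, hψ⟩ := exists_primitive hJ hJ' hw.continuousOn hu₀
  refine ⟨ψ, hψ, ?_, fun b => ?_⟩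
  · obtain ⟨τ, -, -, hτ, -⟩ := exists_smooth_inverse hJ hJ' hw hw0 hψ
    exact Set.LeftInvOn.injOn (f₁' := τ) hτ
  have hψb : ∀ u ∈ J, HasDerivAt (fun u => ψ u + b) (w u) u := fun u hu => (hψ u hu).add_const b
  obtain ⟨τ, hT, hT', hτ, hτs, hτd⟩ := exists_smooth_inverse hJ hJ' hw hw0 hψb
  refine ⟨τ, hτ, ?_⟩
  set T : Set ℝ := (fun u => ψ u + b) '' J with hTdef
  have hmaps : Set.MapsTo τ T J := by
    rintro _ ⟨u, hu, rfl⟩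
    rw [hτ u hu]
    exact hu
  have hτd' : ∀ t ∈ T, HasDerivAt τ (w (τ t))⁻¹ t := by
    rintro _ ⟨u, hu, rfl⟩
    simp only [hτ u hu]
    exact hτd u hu
  have hsm : ContMDiffOn 𝓘(ℝ, ℝ) (𝓡 n) ∞ (σ ∘ τ) T := hs.comp hτs.contMDiffOn hmaps
  rw [isGeodesicOn_iff h]
  refine ⟨hT, hT', ⟨_, u₀, hu₀, rfl⟩, hsm, fun t ht => ?_⟩
  have hr := contDiffOn_position h.1 hsm
  set r : ℝ → EuclideanSpace ℝ (Fin (n + 1)) := fun s => f ((σ ∘ τ) s) with hrdef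
  have hr' := contDiffOn_deriv hT hr
  have hdr : ∀ t ∈ T, HasDerivAt r (deriv r t) t := fun t ht => hasDerivAt_of_contDiffOn hT hr ht
  have hdr' : ∀ t ∈ T, HasDerivAt (deriv r) (deriv (deriv r) t) t :=
    fun t ht => hasDerivAt_of_contDiffOn hT hr' ht
  have hrmem : ∀ t ∈ T, r t ∈ π := fun t ht => hmem _ (hmaps ht)
  have hrmem' : ∀ t ∈ T, deriv r t ∈ π := fun t ht => deriv_mem_of_mem hT hrmem ht (hdr t ht)
  have hrmem'' := deriv_mem_of_mem hT hrmem' ht (hdr' t ht)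
  have hconst : ∀ t ∈ T, Ω (r t) (deriv r t) = C := by
    intro t ht
    have h1 : HasDerivAt r ((w (τ t))⁻¹ • deriv R (τ t)) t :=
      (hdR _ (hmaps ht)).scomp t (hτd' t ht)
    have h2 := hw0 _ (hmaps ht)
    rw [h1.deriv, map_smul, smul_eq_mul]
    have h3 : Ω (r t) (deriv R (τ t)) = C * w (τ t) := by
      simp only [hwdef]
      rw [mul_inv_cancel_left₀ hC]
      rfl
    rw [h3]
    field_simp
  -- Differentiate `Ω(r, r') = C`. As `r` and `r''` both lie in the plane, this makes them parallel.
  have h0 : Ω (r t) (deriv (deriv r) t) = 0 := by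
    have h1 := (Ω.hasFDerivAt.comp_hasDerivAt t (hdr t ht)).clm_apply (hdr' t ht)
    have h2 : (fun s => Ω (r s) (deriv r s)) =ᶠ[nhds t] fun _ => C := by
      filter_upwards [hT.mem_nhds ht] with s hs
      exact hconst s hs
    have h3 := h1.unique ((hasDerivAt_const t C).congr_of_eventuallyEq h2)
    simpa [hΩ0] using h3
  by_contra hno
  push Not at hno
  refine (form_ne_zero_iff_linearIndependent hπ hd hΩ0 hΩ (hrmem t ht) hrmem'').2 ?_ h0
  exact (LinearIndependent.pair_iff' (position_ne_zero h _)).2 fun a ha => hno a ha.symm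

/-- A maximal nonconstant geodesic is a maximal curve in its plane. -/
theorem IsGeodesicOn.isMaximalCurveInPlane [IsManifold (𝓡 n) ∞ M]
    (h : IsCentroaffineNormalization f ξ)
    {π : Submodule ℝ (EuclideanSpace ℝ (Fin (n + 1)))} (hπ : Module.finrank ℝ π = 2)
    {d : π [⋀^Fin 2]→ₗ[ℝ] ℝ} (hd : d ≠ 0) {γ : ℝ → M} {I : Set ℝ}
    (hγ : IsGeodesicOn (inducedConnection h.1) γ I) (hγπ : IsCurveInPlane f π γ I)
    (hmax : ∀ (σ : ℝ → M) (J : Set ℝ), IsGeodesicOn (inducedConnection h.1) σ J →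
        I ⊆ J → Set.EqOn γ σ I → J ⊆ I) :
    IsMaximalCurveInPlane f π γ I := by
  refine ⟨hγπ, fun σ J J' φ hσ hJ' hφ heq => hJ'.antisymm ?_⟩
  obtain ⟨Ω, hΩ0, hΩ⟩ := exists_extension_of_det d
  obtain ⟨t₀, ht₀⟩ := hγπ.nonempty
  have hr := contDiffOn_position h.1 hγπ.smooth
  set C := Ω (f (γ t₀)) (deriv (fun s => f (γ s)) t₀) with hCdef
  have hC : C ≠ 0 :=
    (form_ne_zero_iff_linearIndependent hπ hd hΩ0 hΩ (hγπ.mem_plane t₀ ht₀)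
      (deriv_mem_of_mem hγπ.isOpen hγπ.mem_plane ht₀
        (hasDerivAt_of_contDiffOn hγπ.isOpen hr ht₀))).2
      (linearIndependent_position_deriv h hγπ.isOpen hγπ.smooth ht₀ (hγπ.regular t₀ ht₀))
  obtain ⟨ψ, hψ, hinj, hτ⟩ := hσ.exists_geodesic_reparametrization h hπ hd hΩ0 hΩ hC
  have hφJ : ∀ t ∈ I, φ t ∈ J := fun t ht => hJ' (hφ.image_eq ▸ Set.mem_image_of_mem φ ht)
  -- With the same `C` for both curves, `(ψ ∘ φ)' = C⁻¹ Ω(r, r') = 1` for `r = f ∘ γ`. So `ψ ∘ φ` is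
  -- a translation, which the shift `b` undoes.
  have hψφ : ∀ t ∈ I, HasDerivAt (fun t => ψ (φ t) - t) 0 t := by
    intro t ht
    have h1 : HasDerivAt φ (deriv φ t) t := hasDerivAt_of_contDiffOn hγπ.isOpen hφ.smooth ht
    have h2 : HasDerivAt (fun s => f (σ s)) (deriv (fun s => f (σ s)) (φ t)) (φ t) :=
      hasDerivAt_of_contDiffOn hσ.isOpen (contDiffOn_position h.1 hσ.smooth) (hφJ t ht)
    have h3 : HasDerivAt (fun s => f (γ s)) (deriv φ t • deriv (fun s => f (σ s)) (φ t)) t := by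
      refine (h2.scomp t h1).congr_of_eventuallyEq ?_
      filter_upwards [hγπ.isOpen.mem_nhds ht] with s hs
      simp [heq s hs]
    have h4 := hγ.form_eq h hΩ0 ht ht₀
    rw [h3.deriv, map_smul, smul_eq_mul, heq t ht] at h4
    refine (((hψ _ (hφJ t ht)).comp t h1).sub (hasDerivAt_id t)).congr_deriv ?_
    rw [mul_assoc, mul_comm _ (deriv φ t), h4, ← hCdef, inv_mul_cancel₀ hC, sub_self]
  have hb : ∀ t ∈ I, ψ (φ t) + -(ψ (φ t₀) - t₀) = t := by
    intro t ht
    have := eq_of_hasDerivAt_zero hγπ.isOpen hγπ.ordConnected hψφ ht ht₀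
    linarith
  obtain ⟨τ, hτ, hgeo⟩ := hτ (-(ψ (φ t₀) - t₀))
  -- The reparametrized `σ` is a geodesic extending `γ`, so its domain is contained in `I`.
  have hsub := hmax _ _ hgeo (fun t ht => ⟨φ t, hφJ t ht, hb t ht⟩) (fun t ht => by
    have h1 := hτ (φ t) (hφJ t ht)
    rw [hb t ht] at h1
    simp [h1, heq t ht])
  intro u hu
  have huI := hsub ⟨u, hu, rfl⟩
  have h1 := hb _ huI
  simp only [add_left_inj] at h1
  rw [← hφ.image_eq, ← hinj (hφJ _ huI) hu h1]
  exact Set.mem_image_of_mem φ huI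

/-- A function on the line whose derivative is bounded away from zero is surjective. -/
theorem surjective_of_le_abs_deriv {φ : ℝ → ℝ} (hφ : ContDiff ℝ ∞ φ) {δ : ℝ} (hδ : 0 < δ)
    (h : ∀ t, δ ≤ |deriv φ t|) : Function.Surjective φ := by
  have key : ∀ g : ℝ → ℝ, ContDiff ℝ ∞ g → (∀ t, δ ≤ deriv g t) → Function.Surjective g := by
    intro g hg hd
    -- Monotonicity of `g t - δ t` puts `g` above `δ t + g 0` for `t ≥ 0` and below it for `t ≤ 0`.
    have hmono : Monotone fun t => g t - δ * t := by
      refine monotone_of_deriv_nonneg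
        ((hg.differentiable (by simp)).sub (differentiable_id.const_mul δ)) fun t => ?_
      have h1 : HasDerivAt (fun t => g t - δ * t) (deriv g t - δ * 1) t :=
        ((hg.differentiable (by simp)) t).hasDerivAt.sub ((hasDerivAt_id t).const_mul δ)
      rw [h1.deriv]
      linarith [hd t]
    refine hg.continuous.surjective ?_ ?_
    · refine Filter.tendsto_atTop_mono' (f₁ := fun t => δ * t + g 0) _ ?_
        (Filter.tendsto_atTop_add_const_right _ _ (Filter.tendsto_id.const_mul_atTop hδ))
      filter_upwards [Filter.eventually_ge_atTop 0] with t ht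
      have := hmono ht
      simp only [mul_zero, sub_zero] at this
      linarith
    · refine Filter.tendsto_atBot_mono' (f₁ := fun t => δ * t + g 0) _ ?_
        (Filter.tendsto_atBot_add_const_right _ _ (Filter.tendsto_id.const_mul_atBot hδ))
      filter_upwards [Filter.eventually_le_atBot 0] with t ht
      have := hmono ht
      simp only [mul_zero, sub_zero] at this
      linarith
  have hne : ∀ t, deriv φ t ≠ 0 := fun t h0 => by
    have := h t
    rw [h0, abs_zero] at this
    linarith
  have hcont : Continuous (deriv φ) := hφ.continuous_deriv (by simp)
  have hsign : (∀ t, 0 < deriv φ t) ∨ ∀ t, deriv φ t < 0 := by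
    by_contra hcon
    push Not at hcon
    obtain ⟨⟨a, ha⟩, b, hb⟩ := hcon
    obtain ⟨c, hc⟩ := mem_range_of_exists_le_of_exists_ge hcont ⟨a, ha⟩ ⟨b, hb⟩
    exact hne c hc
  rcases hsign with hs | hs
  · exact key φ hφ fun t => by simpa [abs_of_pos (hs t)] using h t
  · intro y
    obtain ⟨t, ht⟩ := key (fun t => -φ t) hφ.neg (fun t => by
      have := h t
      rw [abs_of_neg (hs t)] at this
      simpa using this) (-y)
    exact ⟨t, neg_injective ht⟩

end MaximalCurve
end AffineHypersurface

end

/-! ### Completeness -/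

theorem theorem5p3 {n : ℕ} {M : Type*} [TopologicalSpace M] [T2Space M]
    [ChartedSpace (EuclideanSpace ℝ (Fin n)) M] [IsManifold (𝓡 n) ∞ M]
    (f ξ : M → EuclideanSpace ℝ (Fin (n + 1)))
    (hfξ : AffineHypersurface.IsCentroaffineNormalization f ξ)
    -- an arbitrarily chosen determinant on each plane through the origin
    (det : ∀ π : Submodule ℝ (EuclideanSpace ℝ (Fin (n + 1))), π [⋀^Fin 2]→ₗ[ℝ] ℝ)
    (hdet : ∀ π : Submodule ℝ (EuclideanSpace ℝ (Fin (n + 1))),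
      Module.finrank ℝ π = 2 → det π ≠ 0)
    (hcurves : ∀ π : Submodule ℝ (EuclideanSpace ℝ (Fin (n + 1))), Module.finrank ℝ π = 2 →
      ∀ (γ : ℝ → M) (I : Set ℝ), AffineHypersurface.IsMaximalCurveInPlane f π γ I →
        AffineHypersurface.HasGlobalParametrization f π (det π) γ I) :
    AffineHypersurface.IsCompleteConnection (AffineHypersurface.inducedConnection hfξ.1) := by
  open AffineHypersurface in
  intro γ₀ I₀ h₀
  obtain ⟨γ, I, hγ, hI₀, heq, hmax⟩ := exists_maximal_geodesic hfξ h₀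
  by_cases hv : ∃ t ∈ I, velocity n γ t = 0
  · obtain ⟨t₀, ht₀, hv⟩ := hv
    refine ⟨fun _ => γ t₀, isGeodesicOn_const hfξ _, fun t ht => ?_⟩
    rw [← heq ht]
    exact eq_of_velocity_eq_zero hγ.isOpen hγ.ordConnected hγ.smooth
      (fun u hu => hγ.velocity_eq_zero hfξ ht₀ hu hv) ht₀ (hI₀ ht)
  push Not at hv
  obtain ⟨t₀, ht₀⟩ := hγ.nonempty
  have hli := linearIndependent_position_deriv hfξ hγ.isOpen hγ.smooth ht₀ (hv t₀ ht₀)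
  set π := Submodule.span ℝ (Set.range ![f (γ t₀), deriv (fun s => f (γ s)) t₀]) with hπdef
  have hπ : Module.finrank ℝ π = 2 := by simpa using finrank_span_eq_card hli
  have hγπ : IsCurveInPlane f π γ I := ⟨hγ.isOpen, hγ.ordConnected, hγ.nonempty, hγ.smooth, hv,
    fun t ht => hγ.mem_span hfξ hv ht₀ ht⟩
  obtain ⟨φ, hφ, r, hr, c, hc, hbound⟩ := hcurves π hπ γ I
    (hγ.isMaximalCurveInPlane hfξ hπ (hdet π hπ) hγπ hmax)
  obtain ⟨Ω, hΩ0, hΩ⟩ := exists_extension_of_det (det π)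
  set C := Ω (f (γ t₀)) (deriv (fun s => f (γ s)) t₀) with hCdef
  have hφI : ∀ t, φ t ∈ I := fun t => hφ.image_eq ▸ Set.mem_image_of_mem φ (Set.mem_univ t)
  have hφs : ContDiff ℝ ∞ φ := contDiffOn_univ.1 hφ.smooth
  have hprod : ∀ t, c ≤ |deriv φ t| * |C| := by
    intro t
    -- Where `r` is not differentiable, `deriv r t` has the default value `0`, so the determinant
    -- would vanish, against the lower bound.
    have hrd : DifferentiableAt ℝ r t := by
      by_contra hnd
      have h1 := hbound t
      have h2 : det π ![r t, 0] = 0 := (det π).map_coord_zero 1 rfl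
      rw [deriv_zero_of_not_differentiableAt hnd, h2, abs_zero] at h1
      linarith
    have h1 : HasDerivAt (fun s => (r s : EuclideanSpace ℝ (Fin (n + 1))))
        ((deriv r t : π) : EuclideanSpace ℝ (Fin (n + 1))) t :=
      π.subtypeL.hasFDerivAt.comp_hasDerivAt t hrd.hasDerivAt
    have h2 := hasDerivAt_of_contDiffOn hγ.isOpen (contDiffOn_position hfξ.1 hγ.smooth) (hφI t)
    have h3 : HasDerivAt (fun s => f (γ (φ s)))
        (deriv φ t • deriv (fun s => f (γ s)) (φ t)) t :=
      h2.scomp t ((hφs.differentiable (by simp)) t).hasDerivAt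
    rw [show (fun s => f (γ (φ s))) = fun s => (r s : EuclideanSpace ℝ (Fin (n + 1))) from
      funext fun s => (hr s).symm] at h3
    have h4 := hbound t
    -- By the chain rule the determinant is `φ' t` times the area form of the geodesic at `φ t`,
    -- which equals its value `C` at `t₀`.
    rw [← hΩ, h1.unique h3, hr, map_smul, smul_eq_mul, hγ.form_eq hfξ hΩ0 (hφI t) ht₀,
      abs_mul] at h4
    exact h4
  have hC : 0 < |C| := by
    refine abs_pos.2 fun h0 => ?_
    have := hprod 0
    rw [h0, abs_zero, mul_zero] at this
    linarith
  have hsurj := surjective_of_le_abs_deriv hφs (div_pos hc hC) fun t =>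
    (div_le_iff₀ hC).2 (hprod t)
  have hI : I = Set.univ := by
    rw [← hφ.image_eq, Set.image_univ, hsurj.range_eq]
  exact ⟨γ, hI ▸ hγ, fun t ht => heq ht⟩
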